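/- Let $m>5$, $r\ge 1$ and $n\ge 6.285214\,m$ be integers. Let $V$ be a set with $|V|=n$ and let $W\subseteq V$ with $|W|=m$; write $K_n^5$ and $K_m^5$ for the sets $\binom{V}{5}$ and $\binom{W}{5}$ of all $5$-element subsets of $V$ and of $W$. A partial $r$-factorization of $K_m^5$ (with respect to $n$) is a coloring of $K_m^5$ that uses at most $\binom{n-1}{4}/r$ colors and in which every vertex lies in at most $r$ sets of each color. An $r$-factorization of $K_n^5$ is a coloring of $K_n^5$ in which every vertex of $V$ lies in exactly $r$ sets of each color that is used. Then any given partial $r$-factorization of $K_m^5$ can be extended to an $r$-factorization of $K_n^5$ (that is, there is an $r$-factorization of $K_n^5$ that agrees with it on $K_m^5$) if and only if $5\mid rn$ and $r\mid\binom{n-1}{4}$. -/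

import Mathlib

/-- The edge set of the complete `h`-uniform hypergraph on the vertex set `W`:
all `h`-element subsets of `W`. -/
abbrev completeEdges {V : Type*} (W : Finset V) (h : ℕ) : Finset (Finset V) :=
  W.powersetCard h

/-- The degree of `v` in the colour class `c` of a coloured edge set `S`: the number of edges in `S`
of colour `c` that contain `v`. A colouring of `S` is given by a function on all finite sets; only
its values on `S` matter. -/
def colorDegree {V : Type*} [DecidableEq V] (S : Finset (Finset V)) (f : Finset V → ℕ)
    (c : ℕ) (v : V) : ℕ :=
  (S.filter fun e => f e = c ∧ v ∈ e).card

/-- `f` is a partial `r`-factorization of a set `S` of `h`-subsets of `V`, where `|V| = n`: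
at most `C(n-1, h-1) / r` colours occur on `S` (written without division, `r` being positive),
and every vertex has degree at most `r` in every colour class. -/
def IsPartialFactorization {V : Type*} [Fintype V] [DecidableEq V] (h r : ℕ)
    (S : Finset (Finset V)) (f : Finset V → ℕ) : Prop :=
  S ⊆ completeEdges Finset.univ h ∧
  r * (S.image f).card ≤ (Fintype.card V - 1).choose (h - 1) ∧
  ∀ (c : ℕ) (v : V), colorDegree S f c v ≤ r

/-- `g` is an `r`-factorization of the complete `h`-uniform hypergraph on `V`: every vertex has
degree exactly `r` in every (nonempty) colour class. -/
def IsFactorization {V : Type*} [Fintype V] [DecidableEq V] (h r : ℕ)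
    (g : Finset V → ℕ) : Prop :=
  ∀ c ∈ (completeEdges (Finset.univ : Finset V) h).image g, ∀ v : V,
    colorDegree (completeEdges Finset.univ h) g c v = r

/-- The colouring `f` of `S` extends to an `r`-factorization of the complete `h`-uniform
hypergraph on `V`. -/
def ExtendsToFactorization {V : Type*} [Fintype V] [DecidableEq V] (h r : ℕ)
    (S : Finset (Finset V)) (f : Finset V → ℕ) : Prop :=
  ∃ g : Finset V → ℕ, IsFactorization h r g ∧ ∀ e ∈ S, g e = f e

/-!
The divisibility conditions are necessary by double counting (`IsFactorization.dvd`). For the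
converse, fix a set of `k = C(n - 1, 4) / r` colours containing those already used, and proceed in
two stages.

The first stage colours greedily all edges with at least two vertices in `W`, keeping every degree
in `W` at most `r` (`exists_greedy_coloring`). The edges are treated in order of decreasing
intersection with `W`. When an edge with `t` vertices in `W` is due, only edges with at least `t`
vertices in `W` have been coloured, and these make up at most a proportion `1 / t` of the total
degree `r * k = C(n - 1, 4)` of a vertex of `W`. So fewer than `k / t` colours are saturated at each
of the `t` vertices, and a colour remains. For `t = 2` the proportion is
`1 - C(n - m, 4) / C(n - 1, 4)`, about `1 - (1 - m / n) ^ 4`, which is where the constant `6.285214`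
comes from; for `t = 3` and `t = 4` a crude bound is enough.

For the second stage, amalgamate the vertices outside `W` into one point. Each edge then retains
only its trace on `W`, and a colouring only records how many edges of each colour have each trace.
Edges with one vertex in `W` fill up the degrees in `W` to `r`, and edges with none fill up the
number of edges of each colour to `r * n / 5` (`exists_isAmalgamatedFactorization`). The vertices
outside `W` are then split off one at a time, as in Baranyai's theorem
(`IsAmalgamatedFactorization.exists_insert`): each step needs a natural matrix with prescribed row
and column sums below given bounds, and it is found by rounding an evident fractional solution
(`exists_int_rounding`). When all vertices have been split off, an honest factorization remains.
-/

open Finset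

/-! ### Rounding matrices with integral row and column sums -/

/-- A nonempty bipartite graph without vertices of degree one (its edges being the elements of `F`)
carries a nonzero edge weighting whose sum at every vertex vanishes. There are at least as many
edges as vertices, and one of the vertex equations is redundant, since the row sums and the column
sums have the same total; so the homogeneous system has more unknowns than equations. -/
theorem exists_ne_zero_of_two_le_degree {α β : Type*} [DecidableEq α] [DecidableEq β]
    (F : Finset (α × β)) (hF : F.Nonempty)
    (hrow : ∀ p ∈ F, ∃ q ∈ F, q ≠ p ∧ q.1 = p.1)
    (hcol : ∀ p ∈ F, ∃ q ∈ F, q ≠ p ∧ q.2 = p.2) :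
    ∃ z : α × β → ℝ, (∃ p ∈ F, z p ≠ 0) ∧ (∀ p ∉ F, z p = 0) ∧
      (∀ a, ∑ p ∈ F with p.1 = a, z p = 0) ∧ ∀ b, ∑ p ∈ F with p.2 = b, z p = 0 := by
  classical
  have hR : 2 * #(F.image Prod.fst) ≤ #F := by
    refine mul_card_image_le_card _ _ fun a ha => ?_
    obtain ⟨p, hp, rfl⟩ := mem_image.1 ha
    obtain ⟨q, hq, hne, he⟩ := hrow p hp
    exact one_lt_card.2 ⟨q, by simp [hq, he], p, by simp [hp], hne⟩
  have hS : 2 * #(F.image Prod.snd) ≤ #F := by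
    refine mul_card_image_le_card _ _ fun a ha => ?_
    obtain ⟨p, hp, rfl⟩ := mem_image.1 ha
    obtain ⟨q, hq, hne, he⟩ := hcol p hp
    exact one_lt_card.2 ⟨q, by simp [hq, he], p, by simp [hp], hne⟩
  obtain ⟨p₀, hp₀⟩ := hF
  have hb₀ : p₀.2 ∈ F.image Prod.snd := mem_image_of_mem _ hp₀
  -- The equation of the column `p₀.2` is left out and recovered at the end from the others.
  let S := (F.image Prod.snd).erase p₀.2
  have hScard : #S + 1 = #(F.image Prod.snd) := card_erase_add_one hb₀
  let L : (F → ℝ) →ₗ[ℝ] (F.image Prod.fst → ℝ) × (S → ℝ) :=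
    LinearMap.prod
      (LinearMap.pi fun a => ∑ p : F with p.1.1 = a.1, LinearMap.proj p)
      (LinearMap.pi fun b => ∑ p : F with p.1.2 = b.1, LinearMap.proj p)
  have hker : LinearMap.ker L ≠ ⊥ := by
    refine LinearMap.ker_ne_bot_of_finrank_lt ?_
    simp only [Module.finrank_prod, Module.finrank_fintype_fun_eq_card, Fintype.card_coe]
    omega
  obtain ⟨y, hy, hy0⟩ := Submodule.exists_mem_ne_zero_of_ne_bot hker
  let z : α × β → ℝ := fun p => if hp : p ∈ F then y ⟨p, hp⟩ else 0
  have hsum : ∀ (P : α × β → Prop) [DecidablePred P], ∑ p ∈ F with P p, z p = ∑ p : F with P p.1, y p := by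
    intro P _
    rw [sum_filter, sum_filter, ← sum_coe_sort F]
    refine sum_congr rfl fun p _ => ?_
    simp [z]
  have hrow0 : ∀ a, ∑ p ∈ F with p.1 = a, z p = 0 := by
    intro a
    by_cases ha : a ∈ F.image Prod.fst
    · rw [hsum fun p => p.1 = a]
      have := congrFun (congrArg Prod.fst hy) ⟨a, ha⟩
      simpa [L] using this
    · refine sum_eq_zero fun p hp => ?_
      rw [mem_filter] at hp
      exact absurd (mem_image.2 ⟨p, hp⟩) ha
  have hcol0 : ∀ b, b ≠ p₀.2 → ∑ p ∈ F with p.2 = b, z p = 0 := by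
    intro b hb
    by_cases hbS : b ∈ F.image Prod.snd
    · rw [hsum fun p => p.2 = b]
      have := congrFun (congrArg Prod.snd hy) ⟨b, mem_erase.2 ⟨hb, hbS⟩⟩
      simpa [L] using this
    · refine sum_eq_zero fun p hp => ?_
      rw [mem_filter] at hp
      exact absurd (mem_image.2 ⟨p, hp⟩) hbS
  refine ⟨z, ?_, fun p hp => by simp [z, hp], hrow0, fun b => ?_⟩
  · obtain ⟨p, hp⟩ := Function.ne_iff.1 hy0
    exact ⟨p.1, p.2, by simpa [z] using hp⟩
  · by_cases hb : b = p₀.2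
    · subst hb
      have h1 : ∑ p ∈ F, z p = 0 := by
        rw [← sum_fiberwise_of_maps_to (g := Prod.fst) (t := F.image Prod.fst)
          fun p hp => mem_image_of_mem _ hp]
        exact sum_eq_zero fun a _ => hrow0 a
      rw [← sum_fiberwise_of_maps_to (g := Prod.snd) (t := F.image Prod.snd)
          fun p hp => mem_image_of_mem _ hp, ← add_sum_erase _ _ hb₀,
          sum_eq_zero (s := (F.image Prod.snd).erase p₀.2)
            fun b hb => hcol0 b (ne_of_mem_erase hb), add_zero] at h1
      exact h1
    · exact hcol0 b hb

/-- A real matrix whose row and column sums are integers can be rounded, each entry up or down, to an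
integer matrix with the same row and column sums. As long as there are nonintegral entries, they
form a bipartite graph without vertices of degree one, so the matrix can be moved along a direction
supported on them until one more entry becomes an integer. -/
theorem exists_int_rounding {α β : Type*} [Fintype α] [Fintype β] (x : α → β → ℝ)
    (hrow : ∀ a, ∑ b, x a b ∈ (Int.castAddHom ℝ).range)
    (hcol : ∀ b, ∑ a, x a b ∈ (Int.castAddHom ℝ).range) :
    ∃ y : α → β → ℤ, (∀ a b, ⌊x a b⌋ ≤ y a b ∧ y a b ≤ ⌈x a b⌉) ∧
      (∀ a, (∑ b, y a b : ℝ) = ∑ b, x a b) ∧ ∀ b, (∑ a, y a b : ℝ) = ∑ a, x a b := by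
  classical
  induction hk : #{p : α × β | x p.1 p.2 ∉ (Int.castAddHom ℝ).range} using Nat.strong_induction_on
    generalizing x with
  | _ k ih =>
  subst hk
  set F : Finset (α × β) := {p : α × β | x p.1 p.2 ∉ (Int.castAddHom ℝ).range} with hFdef
  have hmemF : ∀ a b, (a, b) ∈ F ↔ x a b ∉ (Int.castAddHom ℝ).range := by simp [F]
  rcases F.eq_empty_or_nonempty with hF | hF
  · have hx : ∀ a b, (⌊x a b⌋ : ℝ) = x a b := by
      intro a b
      have : x a b ∈ (Int.castAddHom ℝ).range := by
        by_contra hab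
        simpa [hF] using (hmemF a b).2 hab
      obtain ⟨z, hz⟩ := this
      rw [← hz]
      simp
    exact ⟨fun a b => ⌊x a b⌋, fun a b => ⟨le_rfl, Int.floor_le_ceil _⟩,
      fun a => sum_congr rfl fun b _ => hx a b, fun b => sum_congr rfl fun a _ => hx a b⟩
  · obtain ⟨z, ⟨p₁, hp₁F, hp₁⟩, hz0, hzrow, hzcol⟩ :=
      exists_ne_zero_of_two_le_degree F hF
        (by
          rintro ⟨a, b⟩ hab
          by_contra! hne
          refine (hmemF a b).1 hab ?_
          have h1 : ∑ b' ∈ univ.erase b, x a b' ∈ (Int.castAddHom ℝ).range := by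
            refine sum_mem fun b' hb' => ?_
            by_contra hx
            exact hne (a, b') ((hmemF _ _).2 hx) (by simpa using ne_of_mem_erase hb') rfl
          have h2 := hrow a
          rw [← add_sum_erase _ _ (mem_univ b)] at h2
          exact (AddSubgroup.add_mem_cancel_right _ h1).1 h2)
        (by
          rintro ⟨a, b⟩ hab
          by_contra! hne
          refine (hmemF a b).1 hab ?_
          have h1 : ∑ a' ∈ univ.erase a, x a' b ∈ (Int.castAddHom ℝ).range := by
            refine sum_mem fun a' ha' => ?_
            by_contra hx
            exact hne (a', b) ((hmemF _ _).2 hx) (by simpa using ne_of_mem_erase ha') rfl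
          have h2 := hcol b
          rw [← add_sum_erase _ _ (mem_univ a)] at h2
          exact (AddSubgroup.add_mem_cancel_right _ h1).1 h2)
    have hzrow' : ∀ a, ∑ b, z (a, b) = 0 := by
      intro a
      rw [← hzrow a, sum_filter]
      rw [sum_subset (subset_univ F) (fun p _ hp => by simp [hz0 p hp]), Fintype.sum_prod_type,
        sum_comm]
      simp
    have hzcol' : ∀ b, ∑ a, z (a, b) = 0 := by
      intro b
      rw [← hzcol b, sum_filter]
      rw [sum_subset (subset_univ F) (fun p _ hp => by simp [hz0 p hp]), Fintype.sum_prod_type]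
      simp
    -- `τ q` is the time at which the entry `q`, moving with speed `z q`, reaches an integer.
    let τ : α × β → ℝ := fun p =>
      if 0 < z p then (⌈x p.1 p.2⌉ - x p.1 p.2) / z p else (⌊x p.1 p.2⌋ - x p.1 p.2) / z p
    obtain ⟨p, hp, hmin⟩ := exists_min_image {p ∈ F | z p ≠ 0} τ ⟨p₁, by simp [hp₁F, hp₁]⟩
    rw [mem_filter] at hp
    have hτ0 : ∀ q, 0 ≤ τ q := by
      intro q
      simp only [τ]
      split_ifs with h
      · exact div_nonneg (sub_nonneg.2 (Int.le_ceil _)) h.le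
      · exact div_nonneg_of_nonpos (sub_nonpos.2 (Int.floor_le _)) (not_lt.1 h)
    let x' : α → β → ℝ := fun a b => x a b + τ p * z (a, b)
    have hbd : ∀ a b, (⌊x a b⌋ : ℝ) ≤ x' a b ∧ x' a b ≤ ⌈x a b⌉ := by
      intro a b
      have hf := Int.floor_le (x a b)
      have hc := Int.le_ceil (x a b)
      have ht := hτ0 p
      by_cases hz : z (a, b) = 0
      · simp [x', hz, hf, hc]
      · have hab : (a, b) ∈ F := by
          by_contra h
          exact hz (hz0 _ h)
        have hm := hmin (a, b) (by simp [hab, hz])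
        simp only [x']
        rcases lt_or_gt_of_ne hz with hneg | hpos
        · have : τ (a, b) = (⌊x a b⌋ - x a b) / z (a, b) := by simp [τ, hneg.not_gt]
          rw [this, le_div_iff_of_neg hneg] at hm
          constructor <;> nlinarith
        · have : τ (a, b) = (⌈x a b⌉ - x a b) / z (a, b) := by simp [τ, hpos]
          rw [this, le_div_iff₀ hpos] at hm
          constructor <;> nlinarith
    have hsub : ({p : α × β | x' p.1 p.2 ∉ (Int.castAddHom ℝ).range} : Finset _) ⊂ F := by
      rw [ssubset_iff_of_subset]
      · refine ⟨p, hp.1, ?_⟩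
        have hne := hp.2
        simp only [mem_filter, mem_univ, true_and, not_not, x', Prod.mk.eta]
        by_cases h : 0 < z p
        · refine ⟨⌈x p.1 p.2⌉, ?_⟩
          simp only [τ, h, if_true]
          field_simp
          simp
        · refine ⟨⌊x p.1 p.2⌋, ?_⟩
          simp only [τ, h, if_false]
          field_simp
          simp
      · intro q hq
        by_contra hqF
        have h1 : x q.1 q.2 ∈ (Int.castAddHom ℝ).range := by
          by_contra h
          exact hqF ((hmemF q.1 q.2).2 h)
        rw [mem_filter] at hq
        refine hq.2 ?_
        simpa [x', hz0 q hqF] using h1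
    have hrow' : ∀ a, ∑ b, x' a b = ∑ b, x a b := by
      intro a
      simp [x', sum_add_distrib, ← mul_sum, hzrow']
    have hcol' : ∀ b, ∑ a, x' a b = ∑ a, x a b := by
      intro b
      simp [x', sum_add_distrib, ← mul_sum, hzcol']
    obtain ⟨y, hy, hyr, hyc⟩ := ih _ (card_lt_card hsub) x' (fun a => hrow' a ▸ hrow a)
      (fun b => hcol' b ▸ hcol b) rfl
    refine ⟨y, fun a b => ⟨?_, ?_⟩, fun a => (hyr a).trans (hrow' a),
      fun b => (hyc b).trans (hcol' b)⟩
    · exact (Int.le_floor.2 (hbd a b).1).trans (hy a b).1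
    · exact (hy a b).2.trans (Int.ceil_le.2 (hbd a b).2)

/-- `exists_int_rounding` for matrices with entries between `0` and natural upper bounds `u`. -/
theorem exists_nat_rounding {α β : Type*} [Fintype α] [Fintype β] (x : α → β → ℝ)
    (u : α → β → ℕ) (R : α → ℕ) (D : β → ℕ) (hx0 : ∀ a b, 0 ≤ x a b) (hxu : ∀ a b, x a b ≤ u a b)
    (hrow : ∀ a, ∑ b, x a b = R a) (hcol : ∀ b, ∑ a, x a b = D b) :
    ∃ y : α → β → ℕ, (∀ a b, y a b ≤ u a b) ∧
      (∀ a, ∑ b, y a b = R a) ∧ ∀ b, ∑ a, y a b = D b := by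
  obtain ⟨y, hy, hyr, hyc⟩ := exists_int_rounding x
    (fun a => ⟨R a, by simp [hrow a]⟩) (fun b => ⟨D b, by simp [hcol b]⟩)
  have h0 : ∀ a b, 0 ≤ y a b := fun a b => (Int.floor_nonneg.2 (hx0 a b)).trans (hy a b).1
  lift y to α → β → ℕ using h0
  beta_reduce at hyr hyc
  refine ⟨y, fun a b => ?_, fun a => ?_, fun b => ?_⟩
  · have : (y a b : ℤ) ≤ u a b := (hy a b).2.trans (Int.ceil_le.2 (by exact_mod_cast hxu a b))
    exact_mod_cast this
  · have := (hyr a).trans (hrow a)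
    exact_mod_cast this
  · have := (hyc b).trans (hcol b)
    exact_mod_cast this

/-! ### Counting edges by their trace -/

/-- The number of `h`-subsets of `V` whose trace on `U` is `X`: the multiplicity of `X` as an edge
when all vertices outside `U` are amalgamated into a single one. -/
def traceCount {V : Type*} [Fintype V] [DecidableEq V] (h : ℕ) (U X : Finset V) : ℕ :=
  #{e ∈ completeEdges (univ : Finset V) h | e ∩ U = X}

section
variable {V : Type*} [Fintype V] [DecidableEq V] {h : ℕ} {U X : Finset V} {v : V}

theorem traceCount_eq_zero_of_not_subset (hX : ¬X ⊆ U) : traceCount h U X = 0 := by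
  rw [traceCount, card_eq_zero, filter_eq_empty_iff]
  rintro e - rfl
  exact hX inter_subset_right

theorem traceCount_eq_zero_of_lt_card (hX : h < #X) : traceCount h U X = 0 := by
  rw [traceCount, card_eq_zero, filter_eq_empty_iff]
  rintro e he rfl
  have := card_le_card (inter_subset_left : e ∩ U ⊆ e)
  rw [mem_powersetCard_univ] at he
  omega

theorem traceCount_eq_choose (hXU : X ⊆ U) (hX : #X ≤ h) :
    traceCount h U X = (Fintype.card V - #U).choose (h - #X) := by
  rw [traceCount, ← card_compl, ← card_powersetCard]
  refine card_nbij' (fun e => e \ U) (fun s => X ∪ s) ?_ ?_ ?_ ?_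
  · intro e he
    simp only [mem_coe, mem_filter, mem_powersetCard_univ] at he
    obtain ⟨he, rfl⟩ := he
    simp only [mem_coe, mem_powersetCard]
    refine ⟨fun x hx => by simp_all, ?_⟩
    have := card_sdiff_add_card_inter e U
    omega
  · intro s hs
    simp only [mem_coe, mem_powersetCard] at hs
    have hdis : Disjoint X s :=
      disjoint_of_subset_left hXU (disjoint_left.2 fun x hx hxs => by simpa [hx] using hs.1 hxs)
    simp only [mem_coe, mem_filter, mem_powersetCard_univ]
    refine ⟨by rw [card_union_of_disjoint hdis]; omega, ?_⟩
    ext x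
    have := @hXU x
    have := @hs.1 x
    simp only [mem_inter, mem_union, mem_compl] at *
    tauto
  · intro e he
    simp only [mem_coe, mem_filter, mem_powersetCard_univ] at he
    obtain ⟨he, rfl⟩ := he
    ext x
    simp only [mem_inter, mem_union, mem_sdiff]
    tauto
  · intro s hs
    simp only [mem_coe, mem_powersetCard] at hs
    ext x
    have := @hXU x
    have := @hs.1 x
    simp only [mem_sdiff, mem_union, mem_compl] at *
    tauto

theorem traceCount_eq_add (hv : v ∉ U) (hXU : X ⊆ U) : traceCount h U X =
    traceCount h (insert v U) X + traceCount h (insert v U) (insert v X) := by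
  have hvX : v ∉ X := fun h => hv (hXU h)
  rw [traceCount, traceCount, traceCount, ← card_filter_add_card_filter_not (fun e => v ∉ e),
    filter_filter, filter_filter]
  congr 2
  · refine filter_congr fun e _ => ⟨?_, ?_⟩
    · rintro ⟨rfl, he⟩
      rw [inter_insert_of_notMem he]
    · rintro rfl
      have he : v ∉ e := fun he => hvX (by simp [he])
      exact ⟨by rw [inter_insert_of_notMem he], he⟩
  · refine filter_congr fun e _ => ⟨?_, ?_⟩
    · rintro ⟨rfl, he⟩
      rw [inter_insert_of_mem (not_not.1 he)]
    · intro hE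
      have he : v ∈ e := (mem_inter.1 (hE ▸ mem_insert_self v X : v ∈ e ∩ insert v U)).1
      rw [inter_insert_of_mem he] at hE
      refine ⟨?_, not_not.2 he⟩
      rw [← erase_insert hvX, ← hE, erase_insert (by simp [hv])]

/-- Among the `h`-sets with trace `X` on `U`, the proportion containing a given `v ∉ U` is
`(h - |X|) / (|V| - |U|)`. For `h < |X|` the truncated subtraction is harmless, as both sides vanish. -/
theorem traceCount_insert_mul (hv : v ∉ U) (hXU : X ⊆ U) :
    (Fintype.card V - #U) * traceCount h (insert v U) (insert v X) =
      (h - #X) * traceCount h U X := by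
  have hvX : v ∉ X := fun h => hv (hXU h)
  have hU : #(insert v U) ≤ Fintype.card V := card_le_univ _
  rw [card_insert_of_notMem hv] at hU
  rcases lt_or_ge #X h with hX | hX
  · rw [traceCount_eq_choose (insert_subset_insert v hXU)
      (by rw [card_insert_of_notMem hvX]; omega), traceCount_eq_choose hXU hX.le,
      card_insert_of_notMem hv, card_insert_of_notMem hvX]
    obtain ⟨N, hN⟩ : ∃ N, Fintype.card V - #U = N + 1 := ⟨Fintype.card V - #U - 1, by omega⟩
    obtain ⟨j, hj⟩ : ∃ j, h - #X = j + 1 := ⟨h - #X - 1, by omega⟩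
    rw [← Nat.sub_sub, ← Nat.sub_sub, hN, hj, Nat.add_sub_cancel, Nat.add_sub_cancel,
      Nat.add_one_mul_choose_eq, mul_comm]
  · rw [traceCount_eq_zero_of_lt_card (by rw [card_insert_of_notMem hvX]; omega),
      Nat.sub_eq_zero_of_le hX, mul_zero, zero_mul]

theorem sum_eq_sum_notMem_add_insert (v : V) (F : Finset V → ℕ) :
    ∑ X, F X = ∑ X with v ∉ X, (F X + F (insert v X)) := by
  rw [sum_add_distrib, ← sum_filter_add_sum_filter_not univ (fun X => v ∉ X)]
  congr 1
  refine sum_nbij' (fun X => X.erase v) (fun X => insert v X) ?_ ?_ ?_ ?_ ?_ <;>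
    simp +contextual [insert_erase]

end

/-! ### Amalgamated factorizations and splitting off vertices -/

/-- The number `a c X` is meant as the number of edges of colour `c` whose trace on `U` is `X`, in an
`r`-factorization of the complete `h`-uniform hypergraph on `V` in which the vertices outside `U`
have been amalgamated. Every `X` is used as often as it is a trace, every vertex of `U` has degree
`r` in every colour, and every colour class has `q` edges; with `h * q = r * |V|` the amalgamated
vertex then has degree `r * (|V| - |U|)`. The function `a` is defined on all finite sets, and `total`
forces it to vanish off the traces on `U`. -/
structure IsAmalgamatedFactorization {V κ : Type*} [Fintype V] [DecidableEq V] [Fintype κ]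
    (h r q : ℕ) (U : Finset V) (a : κ → Finset V → ℕ) : Prop where
  total : ∀ X, ∑ c, a c X = traceCount h U X
  degree : ∀ c, ∀ w ∈ U, ∑ X with w ∈ X, a c X = r
  size : ∀ c, ∑ X, a c X = q

namespace IsAmalgamatedFactorization
variable {V κ : Type*} [Fintype V] [DecidableEq V] [Fintype κ] {h r q : ℕ} {U : Finset V}
  {a : κ → Finset V → ℕ}

theorem le_traceCount (ha : IsAmalgamatedFactorization h r q U a) (c : κ) (X : Finset V) :
    a c X ≤ traceCount h U X :=
  ha.total X ▸ single_le_sum (f := fun c => a c X) (fun _ _ => Nat.zero_le _) (mem_univ c)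

theorem eq_zero (ha : IsAmalgamatedFactorization h r q U a) (c : κ) {X : Finset V}
    (hX : traceCount h U X = 0) : a c X = 0 :=
  Nat.le_zero.1 (hX ▸ ha.le_traceCount c X)

/-- The degree of the amalgamated vertex in each colour, counted with multiplicity. -/
theorem sum_mul_sub_card (ha : IsAmalgamatedFactorization h r q U a)
    (hq : h * q = r * Fintype.card V) (c : κ) :
    ∑ X, a c X * (h - #X) = r * (Fintype.card V - #U) := by
  have h1 : ∑ X, a c X * #X = r * #U := by
    calc ∑ X, a c X * #X = ∑ X, ∑ w ∈ U, if w ∈ X then a c X else 0 := by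
          refine sum_congr rfl fun X _ => ?_
          by_cases hX : X ⊆ U
          · rw [← sum_filter, sum_const, filter_mem_eq_inter, inter_eq_right.2 hX, smul_eq_mul,
              mul_comm]
          · simp [ha.eq_zero c (traceCount_eq_zero_of_not_subset hX)]
      _ = ∑ w ∈ U, r := by
          rw [sum_comm]
          refine sum_congr rfl fun w hw => ?_
          rw [← ha.degree c w hw, sum_filter]
      _ = r * #U := by rw [sum_const, smul_eq_mul, mul_comm]
  have h2 : ∑ X, a c X * (h - #X) + ∑ X, a c X * #X = h * q := by
    rw [← sum_add_distrib, ← ha.size c, mul_sum]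
    refine sum_congr rfl fun X _ => ?_
    rcases le_or_gt #X h with hX | hX
    · rw [← mul_add, Nat.sub_add_cancel hX, mul_comm]
    · simp [ha.eq_zero c (traceCount_eq_zero_of_lt_card hX)]
  rw [Nat.mul_sub]
  omega

/-- A new vertex `v` can be split off from the amalgamated one. It has to be put into `b c X` of the
`a c X` edges of colour `c` and trace `X`, with `b` having prescribed row sums `r` and column sums
the number of `h`-sets of trace `X` that contain `v`. The proportional choice
`a c X * (h - |X|) / (|V| - |U|)` has these sums, and it can be rounded. -/
theorem exists_insert (ha : IsAmalgamatedFactorization h r q U a)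
    (hq : h * q = r * Fintype.card V) {v : V} (hv : v ∉ U) :
    ∃ a' : κ → Finset V → ℕ, IsAmalgamatedFactorization h r q (insert v U) a' ∧
      ∀ c X, #X = h → X ⊆ U → a' c X = a c X := by
  have hU : #(insert v U) ≤ Fintype.card V := card_le_univ _
  rw [card_insert_of_notMem hv] at hU
  have hN : 0 < Fintype.card V - #U := by omega
  have hN' : (0 : ℝ) < (Fintype.card V - #U : ℕ) := by exact_mod_cast hN
  obtain ⟨b, hba, hbr, hbc⟩ := exists_nat_rounding
    (fun c X => (a c X * (h - #X : ℕ) / (Fintype.card V - #U : ℕ) : ℝ)) a (fun _ => r)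
    (fun X => if X ⊆ U then traceCount h (insert v U) (insert v X) else 0)
    (fun c X => by positivity)
    (fun c X => by
      rw [div_le_iff₀ hN']
      by_cases h0 : traceCount h U X = 0
      · simp [ha.eq_zero c h0]
      · have hXU : X ⊆ U := by
          by_contra hX
          exact h0 (traceCount_eq_zero_of_not_subset hX)
        have hX : #X ≤ h := by
          by_contra hX
          exact h0 (traceCount_eq_zero_of_lt_card (not_le.1 hX))
        rw [traceCount_eq_choose hXU hX, Nat.choose_eq_zero_iff, not_lt] at h0
        gcongr)
    (fun c => by
      rw [← sum_div, div_eq_iff hN'.ne']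
      exact_mod_cast ha.sum_mul_sub_card hq c)
    (fun X => by
      rw [← sum_div, div_eq_iff hN'.ne', ← sum_mul]
      split_ifs with hXU
      · have := traceCount_insert_mul (h := h) hv hXU
        rw [← ha.total] at this
        rw [mul_comm, mul_comm (_ : ℝ) ((Fintype.card V - #U : ℕ) : ℝ)]
        exact_mod_cast this.symm
      · have : ∑ c, (a c X : ℝ) = 0 := by
          exact_mod_cast (ha.total X).trans (traceCount_eq_zero_of_not_subset hXU)
        simp [this])
  have hva : ∀ c X, v ∈ X → a c X = 0 := fun c X hX =>
    ha.eq_zero c (traceCount_eq_zero_of_not_subset fun hXU => hv (hXU hX))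
  have hvb : ∀ c X, v ∈ X → b c X = 0 := fun c X hX =>
    Nat.le_zero.1 (hva c X hX ▸ hba c X)
  -- `b c Y` of the edges with trace `Y` receive `v`, and the other ones keep their trace.
  let a' : κ → Finset V → ℕ := fun c X => if v ∈ X then b c (X.erase v) else a c X - b c X
  have hsplit : ∀ (c : κ) (P : Finset V → Prop) [DecidablePred P],
      (∀ X, v ∉ X → (P (insert v X) ↔ P X)) → ∑ X with P X, a' c X = ∑ X with P X, a c X := by
    intro c P _ hP
    rw [sum_filter, sum_filter, sum_eq_sum_notMem_add_insert v,
      sum_eq_sum_notMem_add_insert v (fun X => if P X then a c X else 0)]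
    refine sum_congr rfl fun X hX => ?_
    have hX : v ∉ X := (mem_filter.1 hX).2
    have := hba c X
    by_cases hPX : P X
    · simp [hP X hX, hPX, a', hX, hva, this]
    · simp [hP X hX, hPX]
  refine ⟨a', ⟨fun X => ?_, fun c w hw => ?_, fun c => ?_⟩, fun c X hX hXU => ?_⟩
  · by_cases hX : v ∈ X
    · simp only [a', hX, if_true, hbc, insert_erase hX]
      split_ifs with hXU
      · rfl
      · rw [traceCount_eq_zero_of_not_subset]
        rwa [subset_insert_iff]
    · simp only [a', hX, if_false]
      rw [sum_tsub_distrib _ fun c _ => hba c X, ha.total, hbc]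
      split_ifs with hXU
      · rw [traceCount_eq_add hv hXU, Nat.add_sub_cancel]
      · rw [traceCount_eq_zero_of_not_subset hXU, traceCount_eq_zero_of_not_subset]
        rwa [subset_insert_iff_of_notMem hX]
  · rcases eq_or_ne w v with rfl | hwv
    · rw [sum_filter, sum_eq_sum_notMem_add_insert w, ← hbr c, sum_filter]
      refine sum_congr rfl fun X _ => ?_
      by_cases hX : w ∈ X
      · simp [hX, hvb]
      · simp [hX, a']
    · rw [hsplit c (fun X => w ∈ X) fun X _ => by simp [hwv],
        ha.degree c w (mem_of_mem_insert_of_ne hw hwv)]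
  · have := hsplit c (fun _ => True) (by simp)
    simpa [ha.size c] using this
  · have hvX : v ∉ X := fun hvX => hv (hXU hvX)
    have h0 : b c X = 0 := by
      have h1 := hbc X
      rw [if_pos hXU, traceCount_eq_zero_of_lt_card
        (by rw [card_insert_of_notMem hvX]; omega)] at h1
      exact sum_eq_zero_iff.1 h1 c (mem_univ c)
    simp [a', hvX, h0]

theorem exists_univ (ha : IsAmalgamatedFactorization h r q U a)
    (hq : h * q = r * Fintype.card V) :
    ∃ a' : κ → Finset V → ℕ, IsAmalgamatedFactorization h r q univ a' ∧
      ∀ c X, #X = h → X ⊆ U → a' c X = a c X := by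
  have key : ∀ T : Finset V, ∃ a' : κ → Finset V → ℕ,
      IsAmalgamatedFactorization h r q (U ∪ T) a' ∧
        ∀ c X, #X = h → X ⊆ U → a' c X = a c X := by
    intro T
    induction T using Finset.induction_on with
    | empty => exact ⟨a, by simpa using ha, fun _ _ _ _ => rfl⟩
    | insert v T _ ih =>
      obtain ⟨a₁, h₁, hag₁⟩ := ih
      by_cases hv : v ∈ U ∪ T
      · exact ⟨a₁, by rwa [union_insert, insert_eq_of_mem hv], hag₁⟩
      · obtain ⟨a₂, h₂, hag₂⟩ := h₁.exists_insert hq hv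
        refine ⟨a₂, by rwa [union_insert], fun c X hX hXU => ?_⟩
        rw [hag₂ c X hX (hXU.trans subset_union_left), hag₁ c X hX hXU]
  have := key univ
  rwa [union_eq_right.2 (subset_univ U)] at this

/-- Once nothing is amalgamated, every edge has multiplicity one, and `a` is a colouring. -/
theorem exists_coloring [DecidableEq κ] [Nonempty κ]
    (ha : IsAmalgamatedFactorization h r q univ a) :
    ∃ g : Finset V → κ,
      (∀ c v, #{e ∈ completeEdges (univ : Finset V) h | g e = c ∧ v ∈ e} = r) ∧
      ∀ e ∈ completeEdges (univ : Finset V) h, a (g e) e = 1 := by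
  have htot : ∀ e ∈ completeEdges (univ : Finset V) h, ∑ c, a c e = 1 := by
    intro e he
    rw [mem_powersetCard_univ] at he
    rw [ha.total, traceCount_eq_choose (subset_univ e) he.le, he, Nat.sub_self, Nat.choose_zero_right]
  have hex : ∀ e ∈ completeEdges (univ : Finset V) h, ∃ c, a c e ≠ 0 := by
    intro e he
    by_contra! h0
    simpa [h0] using htot e he
  choose! g hg using hex
  have hval : ∀ e ∈ completeEdges (univ : Finset V) h, ∀ c, a c e = if g e = c then 1 else 0 := by
    intro e he c
    have h1 := htot e he
    rw [← add_sum_erase _ _ (mem_univ (g e))] at h1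
    have h2 := hg e he
    split_ifs with hc
    · subst hc
      omega
    · have h3 : ∑ c ∈ univ.erase (g e), a c e = 0 := by omega
      exact sum_eq_zero_iff.1 h3 c (mem_erase.2 ⟨Ne.symm hc, mem_univ c⟩)
  refine ⟨g, fun c v => ?_, fun e he => by simp [hval e he]⟩
  rw [← ha.degree c v (mem_univ v), card_eq_sum_ones, sum_filter, sum_filter]
  refine sum_subset_zero_on_sdiff (subset_univ _) (fun X hX => ?_) (fun e he => ?_)
  · have : traceCount h univ X = 0 := by
      rw [traceCount, card_eq_zero, filter_eq_empty_iff]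
      rintro e he rfl
      rw [inter_univ] at hX
      exact (mem_sdiff.1 hX).2 he
    simp [ha.eq_zero c this]
  · rw [hval e he]
    by_cases h1 : g e = c <;> simp [h1]

end IsAmalgamatedFactorization

/-! ### Greedy colouring and the initial amalgamated factorization -/

section
variable {V κ : Type*} [Fintype V] [DecidableEq V] [Fintype κ] [DecidableEq κ] {h r q : ℕ}
  {W : Finset V}

/-- An edge through `w ∈ W` either meets `W` in another vertex as well or has trace `{w}`. -/
theorem card_filter_mem_two_le_add_traceCount {w : V} (hh : 1 ≤ h) (hw : w ∈ W) :
    #{e ∈ completeEdges (univ : Finset V) h | w ∈ e ∧ 2 ≤ #(e ∩ W)} + traceCount h W {w} =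
      (Fintype.card V - 1).choose (h - 1) := by
  have h1 : traceCount h {w} {w} = (Fintype.card V - 1).choose (h - 1) := by
    rw [traceCount_eq_choose subset_rfl (by simpa using hh), card_singleton]
  rw [← h1, traceCount, traceCount, ← card_filter_add_card_filter_not
    (s := {e ∈ completeEdges (univ : Finset V) h | e ∩ {w} = {w}}) (fun e => 2 ≤ #(e ∩ W)),
    filter_filter, filter_filter]
  congr 2
  · refine filter_congr fun e _ => ?_
    rw [inter_eq_right, singleton_subset_iff]
  · refine filter_congr fun e _ => ?_
    rw [inter_eq_right, singleton_subset_iff]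
    constructor
    · intro he
      refine ⟨(mem_inter.1 (he ▸ mem_singleton_self w : w ∈ e ∩ W)).1, ?_⟩
      rw [he, card_singleton]
      omega
    · rintro ⟨hwe, hlt⟩
      exact (eq_of_subset_of_card_le (singleton_subset_iff.2 (mem_inter.2 ⟨hwe, hw⟩))
        (by rw [card_singleton]; omega)).symm

/-- If the edges coloured so far use less than `1 / |a ∩ W|` of the total capacity at each vertex of
`a ∩ W`, then some colour is saturated at none of these vertices. -/
theorem exists_color_forall_degree_lt {E : Finset (Finset V)} {f : Finset V → κ} {a : Finset V}
    (ha : a ∩ W ≠ ∅)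
    (hdeg : ∀ w ∈ a ∩ W, #(a ∩ W) * (#{e ∈ E | w ∈ e} + 1) ≤ Fintype.card κ * r) :
    ∃ c, ∀ w ∈ a ∩ W, #{e ∈ E | f e = c ∧ w ∈ e} < r := by
  by_contra! hne
  have h1 : ∀ w, ∑ c, #{e ∈ E | f e = c ∧ w ∈ e} = #{e ∈ E | w ∈ e} := by
    intro w
    rw [card_eq_sum_card_fiberwise (f := f) (t := univ) (fun _ _ => mem_univ _)]
    refine sum_congr rfl fun c _ => ?_
    rw [filter_filter]
    simp only [and_comm]
  have h2 : Fintype.card κ * r ≤ ∑ w ∈ a ∩ W, #{e ∈ E | w ∈ e} := by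
    simp_rw [← h1]
    rw [sum_comm, ← smul_eq_mul, ← card_univ, ← sum_const]
    refine sum_le_sum fun c _ => ?_
    obtain ⟨w, hw, hr⟩ := hne c
    exact hr.trans (single_le_sum (f := fun w => #{e ∈ E | f e = c ∧ w ∈ e})
      (fun _ _ => Nat.zero_le _) hw)
  have h3 : #(a ∩ W) * (∑ w ∈ a ∩ W, (#{e ∈ E | w ∈ e} + 1)) ≤
      #(a ∩ W) * (Fintype.card κ * r) := by
    rw [mul_sum]
    exact (sum_le_sum hdeg).trans (by rw [sum_const, smul_eq_mul])
  have h4 := Nat.le_of_mul_le_mul_left h3 (card_pos.2 (nonempty_iff_ne_empty.2 ha))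
  rw [sum_add_distrib, sum_const, smul_eq_mul, mul_one] at h4
  have := card_pos.2 (nonempty_iff_ne_empty.2 ha)
  omega

/-- A colouring of the `h`-subsets of `W` extends greedily to all edges with at least two vertices in
`W`, treating the edges in order of decreasing intersection with `W`. -/
theorem exists_greedy_coloring (f : Finset V → κ)
    (hf : ∀ c, ∀ w ∈ W, #{e ∈ completeEdges W h | f e = c ∧ w ∈ e} ≤ r)
    (hdeg : ∀ t, 2 ≤ t → t < h → ∀ w ∈ W,
      t * #{e ∈ completeEdges (univ : Finset V) h | w ∈ e ∧ t ≤ #(e ∩ W)} ≤ Fintype.card κ * r) :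
    ∃ g : Finset V → κ,
      (∀ c, ∀ w ∈ W,
        #{e ∈ completeEdges (univ : Finset V) h | 2 ≤ #(e ∩ W) ∧ g e = c ∧ w ∈ e} ≤ r) ∧
      ∀ e ∈ completeEdges W h, g e = f e := by
  have key : ∀ T : Finset (Finset V),
      (∀ e ∈ T, #e = h ∧ 2 ≤ #(e ∩ W) ∧ #(e ∩ W) < h) → ∃ g : Finset V → κ,
        (∀ c, ∀ w ∈ W, #{e ∈ completeEdges W h ∪ T | g e = c ∧ w ∈ e} ≤ r) ∧
        ∀ e ∈ completeEdges W h, g e = f e := by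
    intro T
    induction T using Finset.induction_on_min_value (fun e : Finset V => #(e ∩ W)) with
    | empty => exact fun _ => ⟨f, by simpa using hf, fun _ _ => rfl⟩
    | insert a T haT hmin ih =>
      intro hT
      obtain ⟨g, hg, hgf⟩ := ih fun e he => hT e (mem_insert_of_mem he)
      obtain ⟨hah, ha2, halt⟩ := hT a (mem_insert_self a T)
      have haW : a ∉ completeEdges W h := by
        intro ha
        rw [mem_powersetCard] at ha
        rw [inter_eq_left.2 ha.1] at halt
        omega
      have haE : a ∉ completeEdges W h ∪ T := by simp [haW, haT]
      obtain ⟨c, hc⟩ := exists_color_forall_degree_lt (r := r) (f := g)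
        (E := completeEdges W h ∪ T) (a := a) (W := W)
        (by rw [← nonempty_iff_ne_empty, ← card_pos]; omega) (fun w hw => by
          refine le_trans (Nat.mul_le_mul_left _ ?_)
            (hdeg #(a ∩ W) ha2 halt w (mem_inter.1 hw).2)
          rw [← card_insert_of_notMem (s := {e ∈ completeEdges W h ∪ T | w ∈ e}) (a := a)
            (fun h => haE (mem_filter.1 h).1)]
          refine card_le_card fun e he => ?_
          rw [mem_filter, mem_powersetCard_univ]
          rcases mem_insert.1 he with rfl | he
          · exact ⟨hah, (mem_inter.1 hw).1, le_rfl⟩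
          · obtain ⟨he, hwe⟩ := mem_filter.1 he
            rcases mem_union.1 he with he | he
            · rw [mem_powersetCard] at he
              rw [inter_eq_left.2 he.1]
              exact ⟨he.2, hwe, by omega⟩
            · exact ⟨(hT e (mem_insert_of_mem he)).1, hwe, hmin e he⟩)
      refine ⟨Function.update g a c, fun c' w hw => ?_, fun e he => ?_⟩
      · rw [union_insert, filter_insert]
        have heq : {e ∈ completeEdges W h ∪ T | Function.update g a c e = c' ∧ w ∈ e} =
            {e ∈ completeEdges W h ∪ T | g e = c' ∧ w ∈ e} := by
          refine filter_congr fun e he => ?_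
          rw [Function.update_of_ne (ne_of_mem_of_not_mem he haE)]
        rw [heq, Function.update_self]
        split_ifs with hcw
        · obtain ⟨rfl, hwa⟩ := hcw
          exact (card_insert_le _ _).trans (hc w (mem_inter.2 ⟨hwa, hw⟩))
        · exact hg c' w hw
      · rw [Function.update_of_ne (ne_of_mem_of_not_mem he haW), hgf e he]
  obtain ⟨g, hg, hgf⟩ := key
    {e ∈ completeEdges (univ : Finset V) h | 2 ≤ #(e ∩ W) ∧ #(e ∩ W) < h}
    (fun e he => by simpa using he)
  refine ⟨g, fun c w hw => (card_le_card fun e he => ?_).trans (hg c w hw), hgf⟩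
  simp only [mem_filter, mem_union, mem_powersetCard, subset_univ, true_and] at he ⊢
  refine ⟨?_, he.2.2⟩
  rcases lt_or_ge #(e ∩ W) h with hlt | hge
  · exact Or.inr ⟨he.1, he.2.1, hlt⟩
  · refine Or.inl ⟨inter_eq_left.1 (eq_of_subset_of_card_le inter_subset_left ?_), he.1⟩
    omega

/-- A colouring, with degrees at most `r` on `W`, of the edges with at least two vertices in `W` gives
an amalgamated factorization. The edges with trace `{w}` fill the degree of `w` up to `r` in every
colour, and those with empty trace fill every colour class up to `q` edges. There is room for the
latter: a colour class has at most `r * |W| ≤ q` edges meeting `W`. -/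
theorem exists_isAmalgamatedFactorization (hh : 2 ≤ h) (g : Finset V → κ)
    (hk : Fintype.card κ * r = (Fintype.card V - 1).choose (h - 1))
    (hq : h * q = r * Fintype.card V) (hW : h * #W ≤ Fintype.card V)
    (hg : ∀ c, ∀ w ∈ W,
      #{e ∈ completeEdges (univ : Finset V) h | 2 ≤ #(e ∩ W) ∧ g e = c ∧ w ∈ e} ≤ r) :
    ∃ a : κ → Finset V → ℕ, IsAmalgamatedFactorization h r q W a ∧
      ∀ e ∈ completeEdges W h, ∀ c, a c e ≠ 0 → c = g e := by
  obtain ⟨S, hS⟩ : ∃ S : Finset (Finset V),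
    S = {e ∈ completeEdges (univ : Finset V) h | 2 ≤ #(e ∩ W)} := ⟨_, rfl⟩
  have hSmem : ∀ {e}, e ∈ S → #e = h ∧ 2 ≤ #(e ∩ W) := fun he => by simpa [hS] using he
  have hg' : ∀ c, ∀ w ∈ W, #{e ∈ S | g e = c ∧ w ∈ e} ≤ r := by
    intro c w hw
    rw [hS, filter_filter]
    exact hg c w hw
  -- `μ`, `π` and `ω` count the edges with traces of size at least two, one and zero.
  let μ : κ → Finset V → ℕ := fun c X => #{e ∈ S | g e = c ∧ e ∩ W = X}
  let π : κ → Finset V → ℕ := fun c X =>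
    ∑ w ∈ W, if X = {w} then r - #{e ∈ S | g e = c ∧ w ∈ e} else 0
  let ω : κ → Finset V → ℕ := fun c X => if X = ∅ then q - ∑ Y, (μ c Y + π c Y) else 0
  have hμsum : ∀ c (P : Finset V → Prop) [DecidablePred P],
      ∑ X with P X, μ c X = #{e ∈ S | g e = c ∧ P (e ∩ W)} := by
    intro c P _
    rw [card_eq_sum_card_fiberwise (f := fun e => e ∩ W) (t := {X | P X})
      (fun e he => by simpa using (mem_filter.1 he).2.2)]
    refine sum_congr rfl fun X hX => ?_
    rw [filter_filter]
    refine congrArg card (filter_congr fun e _ => ⟨fun he => ⟨⟨he.1, ?_⟩, he.2⟩,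
      fun he => ⟨he.1.1, he.2⟩⟩)
    rw [he.2]
    exact (mem_filter.1 hX).2
  have hμdeg : ∀ c, ∀ w ∈ W, ∑ X with w ∈ X, μ c X = #{e ∈ S | g e = c ∧ w ∈ e} := by
    intro c w hw
    rw [hμsum c (fun X => w ∈ X)]
    simp [hw]
  have hπsum : ∀ c (P : Finset V → Prop) [DecidablePred P],
      ∑ X with P X, π c X =
        ∑ w ∈ W, if P {w} then r - #{e ∈ S | g e = c ∧ w ∈ e} else 0 := by
    intro c P _
    rw [sum_comm]
    refine sum_congr rfl fun w _ => ?_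
    rw [sum_ite_eq']
    simp
  have hsize : ∀ c, ∑ Y, (μ c Y + π c Y) ≤ q := by
    intro c
    have h1 : ∑ Y, μ c Y ≤ ∑ w ∈ W, #{e ∈ S | g e = c ∧ w ∈ e} := by
      have h2 := hμsum c (fun _ => True)
      rw [filter_true_of_mem (by simp)] at h2
      rw [h2]
      refine le_trans (card_le_card fun e he => ?_) card_biUnion_le
      simp only [mem_filter, mem_biUnion, and_true] at he ⊢
      have h3 := (hSmem he.1).2
      obtain ⟨w, hw⟩ : (e ∩ W).Nonempty := card_pos.1 (by omega)
      rw [mem_inter] at hw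
      exact ⟨w, hw.2, he.1, he.2, hw.1⟩
    have h2 : ∑ Y, π c Y = ∑ w ∈ W, (r - #{e ∈ S | g e = c ∧ w ∈ e}) := by
      simpa using hπsum c (fun _ => True)
    have h3 : ∑ Y, (μ c Y + π c Y) ≤ #W * r := by
      rw [sum_add_distrib, h2]
      calc _ ≤ ∑ w ∈ W, #{e ∈ S | g e = c ∧ w ∈ e} +
            ∑ w ∈ W, (r - #{e ∈ S | g e = c ∧ w ∈ e}) := Nat.add_le_add_right h1 _
        _ = #W * r := by
          rw [← sum_add_distrib, sum_congr rfl fun w hw => Nat.add_sub_cancel' (hg' c w hw),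
            sum_const, smul_eq_mul]
    refine Nat.le_of_mul_le_mul_left ?_ (show 0 < h by omega)
    calc _ ≤ h * (#W * r) := Nat.mul_le_mul_left _ h3
      _ = r * (h * #W) := by ring
      _ ≤ r * Fintype.card V := Nat.mul_le_mul_left _ hW
      _ = h * q := hq.symm
  have hωsum : ∀ c, ∑ X, ω c X = q - ∑ Y, (μ c Y + π c Y) := by
    intro c
    simp [ω]
  have hasize : ∀ c, ∑ X, (μ c X + π c X + ω c X) = q := by
    intro c
    rw [sum_add_distrib, hωsum, Nat.add_sub_cancel' (hsize c)]
  have hμtot : ∀ X : Finset V, 2 ≤ #X → ∑ c, μ c X = traceCount h W X := by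
    intro X hX
    rw [traceCount, card_eq_sum_card_fiberwise (f := g) (t := univ) fun _ _ => mem_univ _]
    refine sum_congr rfl fun c _ => ?_
    rw [filter_filter, show μ c X = #{e ∈ S | g e = c ∧ e ∩ W = X} from rfl, hS, filter_filter]
    refine congrArg card (filter_congr fun e _ => ⟨fun he => ⟨he.2.2, he.2.1⟩,
      fun he => ⟨?_, he.2, he.1⟩⟩)
    rwa [he.1]
  have hμ0 : ∀ c (X : Finset V), #X < 2 → μ c X = 0 := by
    intro c X hX
    rw [card_eq_zero, filter_eq_empty_iff]
    rintro e he ⟨-, rfl⟩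
    have := (hSmem he).2
    omega
  have hπ0 : ∀ c (X : Finset V), #X ≠ 1 → π c X = 0 := by
    intro c X hX
    refine sum_eq_zero fun w _ => if_neg ?_
    rintro rfl
    exact hX (card_singleton w)
  have htot : ∀ X : Finset V, X ≠ ∅ → ∑ c, (μ c X + π c X + ω c X) = traceCount h W X := by
    intro X hX
    have hω : ∀ c, ω c X = 0 := fun c => if_neg hX
    have hX0 : 0 < #X := card_pos.2 (nonempty_iff_ne_empty.2 hX)
    simp only [hω, add_zero]
    rcases Nat.lt_or_ge #X 2 with hX2 | hX2
    · simp only [hμ0 _ X hX2, zero_add]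
      obtain ⟨w, rfl⟩ := card_eq_one.1 (show #X = 1 by omega)
      by_cases hw : w ∈ W
      · have hπ : ∀ c, π c {w} = r - #{e ∈ S | g e = c ∧ w ∈ e} := by
          intro c
          simp [π, hw]
        simp only [hπ]
        rw [sum_tsub_distrib _ fun c _ => hg' c w hw, sum_const, smul_eq_mul, card_univ, hk]
        have h1 : ∑ c, #{e ∈ S | g e = c ∧ w ∈ e} = #{e ∈ S | w ∈ e} := by
          rw [card_eq_sum_card_fiberwise (f := g) (t := univ) fun _ _ => mem_univ _]
          refine sum_congr rfl fun c _ => ?_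
          rw [filter_filter]
          simp only [and_comm]
        have h2 : #{e ∈ S | w ∈ e} + traceCount h W {w} = (Fintype.card V - 1).choose (h - 1) := by
          rw [← card_filter_mem_two_le_add_traceCount (by omega) hw, hS, filter_filter]
          simp only [and_comm]
        omega
      · rw [traceCount_eq_zero_of_not_subset (by simpa using hw)]
        refine sum_eq_zero fun c _ => sum_eq_zero fun w' hw' => if_neg ?_
        intro heq
        rw [singleton_inj] at heq
        exact hw (heq ▸ hw')
    · rw [← hμtot X hX2]
      exact sum_congr rfl fun c _ => by rw [hπ0 c X (by omega), add_zero]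
  refine ⟨fun c X => μ c X + π c X + ω c X, ⟨fun X => ?_, fun c w hw => ?_, hasize⟩,
    fun e he c hc => ?_⟩
  · -- The empty trace has the right multiplicity because all other traces do and the sum is right.
    by_cases hX : X = ∅
    · subst hX
      have h1 : ∑ X, traceCount h W X = (Fintype.card V).choose h := by
        rw [← card_univ, ← card_powersetCard]
        exact (card_eq_sum_card_fiberwise (f := fun e => e ∩ W) (t := univ)
          fun _ _ => mem_univ _).symm
      have h2 : ∑ X, ∑ c, (μ c X + π c X + ω c X) = Fintype.card κ * q := by
        rw [sum_comm, sum_congr rfl fun c _ => hasize c, sum_const, smul_eq_mul, card_univ]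
      have h3 : Fintype.card κ * q = (Fintype.card V).choose h := by
        refine Nat.eq_of_mul_eq_mul_left (show 0 < h by omega) ?_
        rw [mul_left_comm, hq, ← mul_assoc, hk]
        rcases Nat.eq_zero_or_pos (Fintype.card V) with h0 | h0
        · rw [h0, mul_zero, Nat.choose_eq_zero_of_lt (by omega), mul_zero]
        · obtain ⟨N, hN⟩ : ∃ N, Fintype.card V = N + 1 := ⟨Fintype.card V - 1, by omega⟩
          obtain ⟨j, rfl⟩ : ∃ j, h = j + 1 := ⟨h - 1, by omega⟩
          rw [hN, Nat.add_sub_cancel, Nat.add_sub_cancel, mul_comm, Nat.add_one_mul_choose_eq,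
            mul_comm]
      have h4 := h2.trans (h3.trans h1.symm)
      rw [← add_sum_erase _ _ (mem_univ ∅),
        ← add_sum_erase _ (fun X => traceCount h W X) (mem_univ ∅),
        sum_congr rfl fun X hX => htot X (ne_of_mem_erase hX)] at h4
      exact Nat.add_right_cancel h4
    · exact htot X hX
  · have h1 : ∑ X with w ∈ X, ω c X = 0 := by
      refine sum_eq_zero fun X hX => if_neg ?_
      rintro rfl
      simp at hX
    have h2 : ∑ X with w ∈ X, π c X = r - #{e ∈ S | g e = c ∧ w ∈ e} := by
      rw [hπsum c (fun X => w ∈ X)]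
      simp [hw]
    rw [sum_add_distrib, sum_add_distrib, h1, h2, hμdeg c w hw, add_zero,
      Nat.add_sub_cancel' (hg' c w hw)]
  · rw [mem_powersetCard] at he
    have hω : ω c e = 0 := if_neg (by rintro rfl; simp at he; omega)
    beta_reduce at hc
    rw [hω, hπ0 c e (by omega), add_zero, add_zero, card_ne_zero] at hc
    obtain ⟨e', he'⟩ := hc
    obtain ⟨he'S, hc', heq⟩ := mem_filter.1 he'
    have h1 : #e' = h := (hSmem he'S).1
    have h2 : e = e' := eq_of_subset_of_card_le (heq ▸ inter_subset_left) (by omega)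
    rw [h2, hc']

/-- The extension theorem for an arbitrary uniformity `h`, with the density hypotheses of the greedy
step and exactly as many colours as a factorization has. -/
theorem exists_factorization_extending [Nonempty κ] (hh : 2 ≤ h) (f : Finset V → κ)
    (hk : Fintype.card κ * r = (Fintype.card V - 1).choose (h - 1))
    (hq : h ∣ r * Fintype.card V) (hW : h * #W ≤ Fintype.card V)
    (hf : ∀ c, ∀ w ∈ W, #{e ∈ completeEdges W h | f e = c ∧ w ∈ e} ≤ r)
    (hdeg : ∀ t, 2 ≤ t → t < h → ∀ w ∈ W,
      t * #{e ∈ completeEdges (univ : Finset V) h | w ∈ e ∧ t ≤ #(e ∩ W)} ≤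
        (Fintype.card V - 1).choose (h - 1)) :
    ∃ g : Finset V → κ,
      (∀ c v, #{e ∈ completeEdges (univ : Finset V) h | g e = c ∧ v ∈ e} = r) ∧
      ∀ e ∈ completeEdges W h, g e = f e := by
  obtain ⟨q, hq⟩ := hq
  obtain ⟨g₁, hg₁, hgf⟩ := exists_greedy_coloring f hf (hk.symm ▸ hdeg)
  obtain ⟨a, ha, hag⟩ := exists_isAmalgamatedFactorization hh g₁ hk hq.symm hW hg₁
  obtain ⟨a', ha', haa'⟩ := ha.exists_univ hq.symm
  obtain ⟨g, hg, hga⟩ := ha'.exists_coloring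
  refine ⟨g, hg, fun e he => ?_⟩
  have he' := mem_powersetCard.1 he
  rw [← hgf e he]
  refine hag e he (g e) ?_
  rw [← haa' (g e) e he'.2 he'.1, hga e (mem_powersetCard_univ.2 he'.2)]
  exact one_ne_zero

end

/-! ### Bounds on degrees -/

theorem cast_choose_three (a : ℕ) : (6 : ℝ) * a.choose 3 = a * (a - 1) * (a - 2) := by
  induction a with
  | zero => simp
  | succ a ih =>
    rw [Nat.choose_succ_succ' a 2]
    push_cast
    rw [Nat.cast_choose_two]
    linear_combination ih

theorem cast_choose_four (a : ℕ) :
    (24 : ℝ) * a.choose 4 = a * (a - 1) * (a - 2) * (a - 3) := by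
  induction a with
  | zero => simp
  | succ a ih =>
    rw [Nat.choose_succ_succ' a 3]
    push_cast
    linear_combination ih + 4 * cast_choose_three a

/-- At most half of the edges through a vertex of `W` meet `W` in a second vertex. The constant is
just above `1 / (1 - 2 ^ (-1 / 4))`, so the leading terms of the two sides nearly agree. -/
theorem choose_four_le_two_mul {m n : ℕ} (hm : 5 < m) (hmn : (6.285214 : ℝ) * m ≤ n) :
    (n - 1).choose 4 ≤ 2 * (n - m).choose 4 := by
  have hm' : (6 : ℝ) ≤ m := by exact_mod_cast hm
  have hmn' : m ≤ n := by
    have : (m : ℝ) ≤ n := by linarith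
    exact_mod_cast this
  have hn : (37 : ℝ) ≤ n := by linarith
  have h1 := cast_choose_four (n - 1)
  have h2 := cast_choose_four (n - m)
  rw [Nat.cast_sub (by omega : 1 ≤ n), Nat.cast_one] at h1
  rw [Nat.cast_sub hmn'] at h2
  set N : ℝ := (n : ℝ)
  set y : ℝ := N - m with hy
  -- `0.84089642` lies between `2 ^ (-1 / 4)` and `1 - 1 / 6.285214`.
  have hyN : 0.84089642 * N ≤ y := by linarith
  have hy3 : 3 ≤ y := by linarith
  have hP : 0.84089642 * N * (0.84089642 * N - 3) ≤ y * (y - 3) := by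
    apply mul_le_mul hyN <;> linarith
  have hQ : 0.84089642 * N * (0.84089642 * N - 3) * (0.84089642 * N * (0.84089642 * N - 3) + 2) ≤
      y * (y - 3) * (y * (y - 3) + 2) := by
    have : 0 ≤ 0.84089642 * N * (0.84089642 * N - 3) := by
      apply mul_nonneg <;> linarith
    apply mul_le_mul hP <;> linarith
  have hR : (N - 1) * (N - 1 - 1) * (N - 1 - 2) * (N - 1 - 3) ≤
      2 * (0.84089642 * N * (0.84089642 * N - 3) * (0.84089642 * N * (0.84089642 * N - 3) + 2)) := by
    -- In terms of `N - 37` the difference of the two sides has nonnegative coefficients.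
    obtain ⟨s, hs, hs'⟩ : ∃ s : ℝ, 0 ≤ s ∧ N = s + 37 := ⟨N - 37, by linarith, by ring⟩
    rw [hs', ← sub_nonneg]
    ring_nf
    positivity
  have h3 : ((n - 1).choose 4 : ℝ) ≤ 2 * (n - m).choose 4 := by
    have : y * (y - 3) * (y * (y - 3) + 2) = y * (y - 1) * (y - 2) * (y - 3) := by ring
    linarith
  exact_mod_cast h3

theorem three_mul_choose_two_mul_le {m n : ℕ} (hm : 3 ≤ m) (hmn : 6 * m ≤ n) :
    3 * ((m - 1).choose 2 * (n - 3).choose 2) ≤ (n - 1).choose 4 := by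
  have hm' : (3 : ℝ) ≤ m := by exact_mod_cast hm
  have hmn' : (6 : ℝ) * m ≤ n := by exact_mod_cast hmn
  have h1 := cast_choose_four (n - 1)
  have h2 := Nat.cast_choose_two ℝ (n - 3)
  have h3 := Nat.cast_choose_two ℝ (m - 1)
  rw [Nat.cast_sub (by omega), Nat.cast_one] at h1 h3
  rw [Nat.cast_sub (by omega), Nat.cast_ofNat] at h2
  have h4 : (18 : ℝ) * ((m - 1) * (m - 2)) ≤ (n - 1) * (n - 2) := by nlinarith
  have h5 : (0 : ℝ) ≤ (n - 3) * (n - 4) := by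
    apply mul_nonneg <;> linarith
  have h6 : (3 : ℝ) * ((m - 1).choose 2 * (n - 3).choose 2) ≤ (n - 1).choose 4 := by
    rw [h2, h3]
    nlinarith [mul_le_mul_of_nonneg_right h4 h5]
  exact_mod_cast h6

theorem four_mul_choose_three_mul_le {m n : ℕ} (hm : 3 ≤ m) (hmn : 6 * m ≤ n) :
    4 * ((m - 1).choose 3 * (n - 4).choose 1) ≤ (n - 1).choose 4 := by
  have hm' : (3 : ℝ) ≤ m := by exact_mod_cast hm
  have hmn' : (6 : ℝ) * m ≤ n := by exact_mod_cast hmn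
  have h1 := cast_choose_four (n - 1)
  have h3 := cast_choose_three (m - 1)
  rw [Nat.cast_sub (by omega), Nat.cast_one] at h1 h3
  have h2 : ((n - 4 : ℕ) : ℝ) = n - 4 := by
    rw [Nat.cast_sub (by omega), Nat.cast_ofNat]
  have h4 : (16 : ℝ) * ((m - 1) * (m - 2)) ≤ (n - 1) * (n - 2) := by nlinarith
  have h5 : (16 : ℝ) * ((m - 1) * (m - 2)) * (m - 3) ≤ (n - 1) * (n - 2) * (n - 3) := by
    apply mul_le_mul h4 <;> nlinarith
  have h6 : (4 : ℝ) * ((m - 1).choose 3 * (n - 4 : ℕ)) ≤ (n - 1).choose 4 := by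
    rw [h2]
    nlinarith [mul_le_mul_of_nonneg_right h5 (by linarith : (0 : ℝ) ≤ n - 4)]
  rw [Nat.choose_one_right]
  exact_mod_cast h6

section
variable {V : Type*} [Fintype V] [DecidableEq V] {h r t : ℕ} {W : Finset V}

/-- Every edge counted contains `t - 1` further vertices of `W`; these are chosen first. -/
theorem card_filter_mem_le_choose_mul_choose {w : V} (hw : w ∈ W) (ht : 1 ≤ t) (hth : t ≤ h) :
    #{e ∈ completeEdges (univ : Finset V) h | w ∈ e ∧ t ≤ #(e ∩ W)} ≤
      (#W - 1).choose (t - 1) * (Fintype.card V - t).choose (h - t) := by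
  calc _ ≤ #((powersetCard (t - 1) (W.erase w)).biUnion fun Y =>
        {e ∈ completeEdges (univ : Finset V) h | e ∩ insert w Y = insert w Y}) := by
        refine card_le_card fun e he => ?_
        rw [mem_filter] at he
        obtain ⟨he, hwe, hte⟩ := he
        obtain ⟨Y, hY, hYt⟩ := exists_subset_card_eq (s := (e ∩ W).erase w) (n := t - 1)
          (by rw [card_erase_of_mem (mem_inter.2 ⟨hwe, hw⟩)]; omega)
        rw [mem_biUnion]
        refine ⟨Y, mem_powersetCard.2 ⟨hY.trans (erase_subset_erase _ inter_subset_right), hYt⟩,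
          mem_filter.2 ⟨he, inter_eq_right.2 (insert_subset hwe ?_)⟩⟩
        exact hY.trans ((erase_subset _ _).trans inter_subset_left)
    _ ≤ #(powersetCard (t - 1) (W.erase w)) * (Fintype.card V - t).choose (h - t) := by
        refine card_biUnion_le_card_mul _ _ _ fun Y hY => ?_
        rw [mem_powersetCard] at hY
        have hc : #(insert w Y) = t := by
          rw [card_insert_of_notMem fun hwY => notMem_erase w W (hY.1 hwY)]
          omega
        exact (traceCount_eq_choose (subset_refl (insert w Y)) (by omega)).le.trans (by rw [hc])
    _ = _ := by rw [card_powersetCard, card_erase_of_mem hw]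

end

/-! ### Necessity and sufficiency of the divisibility conditions -/

section
variable {V : Type*} [Fintype V] [DecidableEq V] {h r : ℕ} {W : Finset V}

theorem sum_card_filter_mem (E : Finset (Finset V)) (hE : E ⊆ completeEdges univ h) :
    ∑ v, #{e ∈ E | v ∈ e} = h * #E := by
  simp_rw [card_filter]
  rw [sum_comm, mul_comm, ← smul_eq_mul, ← sum_const]
  refine sum_congr rfl fun e he => ?_
  have := mem_powersetCard_univ.1 (hE he)
  simpa using this

/-- The divisibility conditions are necessary: count the incidences in one colour class, and the
edges through one vertex by colour. -/
theorem IsFactorization.dvd {g : Finset V → ℕ} (hg : IsFactorization h r g) (hh : 1 ≤ h)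
    (hV : h ≤ Fintype.card V) :
    h ∣ r * Fintype.card V ∧ r ∣ (Fintype.card V - 1).choose (h - 1) := by
  constructor
  · obtain ⟨e, -, he⟩ := exists_subset_card_eq (s := (univ : Finset V)) (n := h) (by rwa [card_univ])
    have h1 := sum_card_filter_mem {e' ∈ completeEdges (univ : Finset V) h | g e' = g e}
      (filter_subset _ _)
    simp_rw [filter_filter] at h1
    have h2 : ∑ v, colorDegree (completeEdges (univ : Finset V) h) g (g e) v =
        Fintype.card V * r := by
      rw [sum_congr rfl fun v _ => hg (g e) (mem_image_of_mem _ (mem_powersetCard_univ.2 he)) v,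
        sum_const, smul_eq_mul, card_univ]
    exact ⟨_, (mul_comm _ _).trans (h2.symm.trans h1)⟩
  · obtain ⟨v⟩ : Nonempty V := Fintype.card_pos_iff.1 (by omega)
    have h1 : #{e ∈ completeEdges (univ : Finset V) h | v ∈ e} =
        (Fintype.card V - 1).choose (h - 1) := by
      rw [← card_singleton v, ← traceCount_eq_choose subset_rfl (by simpa using hh), traceCount]
      simp only [inter_eq_right, singleton_subset_iff]
    rw [← h1, card_eq_sum_card_fiberwise (f := g) (t := (completeEdges univ h).image g)
      fun e he => mem_image_of_mem _ (mem_filter.1 he).1]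
    refine dvd_sum fun c hc => ?_
    rw [filter_filter, ← hg c hc v, colorDegree]
    simp only [and_comm, dvd_refl]

theorem IsPartialFactorization.extendsToFactorization {f : Finset V → ℕ}
    (hf : IsPartialFactorization h r (completeEdges W h) f) (hh : 2 ≤ h) (hr : 0 < r)
    (hV : h ≤ Fintype.card V)
    (hq : h ∣ r * Fintype.card V) (hk : r ∣ (Fintype.card V - 1).choose (h - 1))
    (hW : h * #W ≤ Fintype.card V)
    (hdeg : ∀ t, 2 ≤ t → t < h → ∀ w ∈ W,
      t * #{e ∈ completeEdges (univ : Finset V) h | w ∈ e ∧ t ≤ #(e ∩ W)} ≤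
        (Fintype.card V - 1).choose (h - 1)) :
    ExtendsToFactorization h r (completeEdges W h) f := by
  obtain ⟨k, hk⟩ := hk
  obtain ⟨-, hcol, hfdeg⟩ := hf
  rw [hk] at hcol
  obtain ⟨C, hC, hCk⟩ := Infinite.exists_superset_card_eq _ k (Nat.le_of_mul_le_mul_left hcol hr)
  have hk0 : 0 < k := by
    rw [Nat.pos_iff_ne_zero]
    rintro rfl
    rw [mul_zero, Nat.choose_eq_zero_iff] at hk
    omega
  obtain ⟨c₀, hc₀⟩ : C.Nonempty := card_pos.1 (hCk ▸ hk0)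
  have : Nonempty C := ⟨⟨c₀, hc₀⟩⟩
  let f' : Finset V → C := fun e => if he : f e ∈ C then ⟨f e, he⟩ else ⟨c₀, hc₀⟩
  have hf' : ∀ e ∈ completeEdges W h, (f' e : ℕ) = f e := by
    intro e he
    simp [f', hC (mem_image_of_mem _ he)]
  obtain ⟨g, hg, hgf⟩ := exists_factorization_extending (r := r) hh f'
    (by rw [Fintype.card_coe, hCk, hk, mul_comm]) hq hW
    (fun c w _ => by
      refine le_trans (card_le_card fun e he => ?_) (hfdeg c w)
      rw [mem_filter] at he ⊢
      refine ⟨he.1, ?_, he.2.2⟩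
      rw [← hf' e he.1, he.2.1]) hdeg
  refine ⟨fun e => g e, fun c hc v => ?_, fun e he => by
    rw [← hf' e he, ← hgf e he]⟩
  obtain ⟨e, -, rfl⟩ := mem_image.1 hc
  rw [← hg (g e) v, colorDegree]
  simp only [Subtype.coe_inj]

end

theorem theorem5p1 {V : Type*} [Fintype V] [DecidableEq V] (W : Finset V) (m n r : ℕ)
    (hn : Fintype.card V = n) (hW : W.card = m) (hm : 5 < m) (hr : 0 < r)
    (hmn : (6.285214 : ℝ) * (m : ℝ) ≤ (n : ℝ))
    (f : Finset V → ℕ) (hf : IsPartialFactorization 5 r (completeEdges W 5) f) :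
    ExtendsToFactorization 5 r (completeEdges W 5) f ↔
      5 ∣ r * n ∧ r ∣ (n - 1).choose 4 := by
  subst hn hW
  have h6 : 6 * #W ≤ Fintype.card V := by
    have : (6 : ℝ) * #W ≤ Fintype.card V := by
      have : (0 : ℝ) ≤ #W := by positivity
      linarith
    exact_mod_cast this
  refine ⟨fun ⟨g, hg, _⟩ => hg.dvd (by omega) (by omega), fun ⟨hq, hk⟩ =>
    hf.extendsToFactorization (by omega) hr (by omega) hq hk (by omega) fun t ht2 ht5 w hw => ?_⟩
  obtain rfl | rfl | rfl : t = 2 ∨ t = 3 ∨ t = 4 := by omega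
  · have h1 := card_filter_mem_two_le_add_traceCount (h := 5) (by omega) hw
    rw [traceCount_eq_choose (singleton_subset_iff.2 hw) (by simp), card_singleton] at h1
    have h2 := choose_four_le_two_mul hm hmn
    norm_num at h1 ⊢
    omega
  · exact (Nat.mul_le_mul_left 3 (card_filter_mem_le_choose_mul_choose hw (by omega)
      (by omega))).trans (three_mul_choose_two_mul_le (by omega) h6)
  · exact (Nat.mul_le_mul_left 4 (card_filter_mem_le_choose_mul_choose hw (by omega)
      (by omega))).trans (four_mul_choose_three_mul_le (by omega) h6)
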